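/- Let $\mathbb G$ be a stratified Lie group: an $n$-dimensional connected, simply connected, nilpotent Lie group whose Lie algebra has a decomposition $\mathfrak g=\mathfrak g^1\oplus\cdots\oplus\mathfrak g^r$ with $[\mathfrak g^1,\mathfrak g^j]=\mathfrak g^{j+1}$ for $1\le j<r$ and $[\mathfrak g^j,\mathfrak g^r]=0$ for $1\le j\le r$. Let $D\subset T\mathbb G$ be the left-invariant distribution generated by $\mathfrak g^1$, equipped with a left-invariant positive definite scalar product, and let $\overline\nabla$ be the connection on $T\mathbb G$ for which all left-invariant vector fields are parallel; for a vector field $Y=\sum_j Y^je_j$ along a submanifold $M$, with $e_1,\dots,e_n$ a basis of $\mathfrak g$, and $v\in TM$, this means $\overline\nabla_vY=\sum_j dY^j(v)\,e_j$. Let $M$ be a smooth (immersed) submanifold of $\mathbb G$ that is non-horizontal, i.e. $TM+D=T\mathbb G$ along $M$. Let $TM^\perp\subset D$ be the orthogonal complement of $TM\cap D$ in $D$. Then $T\mathbb G=TM\oplus TM^\perp$ along $M$ (in general not orthogonally), and we write $v=v^\top+v^\perp$ accordingly. For smooth tangent vector fields $X,Y,Z$ and smooth sections $\xi$ of $TM^\perp$,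 defined on an open subset of $M$, put $$\nabla_XY=(\overline\nabla_XY)^\top,\quad S(X,Y)=(\overline\nabla_XY)^\perp,\quad A_\xi X=-(\overline\nabla_X\xi)^\top,\quad \nabla^\perp_X\xi=(\overline\nabla_X\xi)^\perp,$$ $$T(X,Y)=\nabla_XY-\nabla_YX-[X,Y],\qquad K(X,Y)Z=\nabla_X\nabla_YZ-\nabla_Y\nabla_XZ-\nabla_{[X,Y]}Z,$$ $$K^\perp(X,Y)\xi=\nabla^\perp_X\nabla^\perp_Y\xi-\nabla^\perp_Y\nabla^\perp_X\xi-\nabla^\perp_{[X,Y]}\xi,$$ $$\widetilde\nabla_XS(Y,Z)=\nabla^\perp_X\big(S(Y,Z)\big)-S(\nabla_XY,Z)-S(Y,\nabla_XZ).$$ Theorem. On the open set where the fields are defined: 1. (Gauss equation) $K(X,Y)Z=A_{S(Y,Z)}X-A_{S(X,Z)}Y$; 2. (Codazzi equation) $\widetilde\nabla_YS(X,Z)-\widetilde\nabla_XS(Y,Z)-S(T(X,Y),Z)=0$; 3. (Ricci equation) $K^\perp(X,Y)\xi=S(X,A_\xi Y)-S(Y,A_\xi X)$. -/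

import Mathlib

open scoped Manifold ContDiff

noncomputable section

namespace SubRiemannian

open Bundle

/-! ### Left translations of a Lie group -/

section LieGroup

variable {n : ℕ} {G : Type*} [TopologicalSpace G] [ChartedSpace (EuclideanSpace ℝ (Fin n)) G]
  [Group G]

lemma mfderiv_mul_left_congr {g k k' : G} (h : k = k') (w : EuclideanSpace ℝ (Fin n)) :
    (show EuclideanSpace ℝ (Fin n) from mfderiv (𝓡 n) (𝓡 n) (fun h : G ↦ g * h) k w) =
      mfderiv (𝓡 n) (𝓡 n) (fun h : G ↦ g * h) k' w := by
  subst h; rfl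

variable [LieGroup (𝓡 n) ∞ G]

lemma mdifferentiableAt_mul_left' (g h : G) :
    MDifferentiableAt (𝓡 n) (𝓡 n) (fun x : G ↦ g * x) h :=
  (contMDiff_mul_left (I := 𝓡 n) (n := ∞)).contMDiffAt.mdifferentiableAt (by simp)

/-- The differential at `1` of the left translation by `g`, an isomorphism `𝔤 = T₁G ≃ T_gG`. The
vector field `g ↦ leftTranslation g v` is the left-invariant vector field with value `v` at `1`
(Mathlib's `mulInvariantVectorField v`). -/
def leftTranslation (g : G) : GroupLieAlgebra (𝓡 n) G ≃L[ℝ] TangentSpace (𝓡 n) g :=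
  ContinuousLinearEquiv.equivOfInverse
    (mfderiv (𝓡 n) (𝓡 n) (fun h : G ↦ g * h) 1 :
      GroupLieAlgebra (𝓡 n) G →L[ℝ] TangentSpace (𝓡 n) g)
    (mfderiv (𝓡 n) (𝓡 n) (fun h : G ↦ g⁻¹ * h) g :
      TangentSpace (𝓡 n) g →L[ℝ] GroupLieAlgebra (𝓡 n) G)
    (fun v ↦ by
      have h := mfderiv_comp_of_eq (I := 𝓡 n) (I' := 𝓡 n) (I'' := 𝓡 n) (x := (1 : G)) (y := g)
        (mdifferentiableAt_mul_left' g⁻¹ g) (mdifferentiableAt_mul_left' g 1) (mul_one g)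
      have e : (fun x : G ↦ g⁻¹ * x) ∘ (fun x : G ↦ g * x) = id := by ext x; simp
      rw [e, mfderiv_id] at h
      exact (mfderiv_mul_left_congr (mul_one g).symm _).trans (DFunLike.congr_fun h v).symm)
    (fun w ↦ by
      have h := mfderiv_comp_of_eq (I := 𝓡 n) (I' := 𝓡 n) (I'' := 𝓡 n) (x := g) (y := (1 : G))
        (mdifferentiableAt_mul_left' g 1) (mdifferentiableAt_mul_left' g⁻¹ g) (inv_mul_cancel g)
      have e : (fun x : G ↦ g * x) ∘ (fun x : G ↦ g⁻¹ * x) = id := by ext x; simp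
      rw [e, mfderiv_id] at h
      exact (mfderiv_mul_left_congr (inv_mul_cancel g).symm _).trans
        (DFunLike.congr_fun h w).symm)

lemma leftTranslation_apply (g : G) (v : GroupLieAlgebra (𝓡 n) G) :
    leftTranslation g v = mulInvariantVectorField v g := rfl

/-- The left trivialisation `TG → 𝔤` (the Maurer-Cartan form): it sends `w ∈ T_gG` to the
`v ∈ 𝔤` whose left-invariant vector field has value `w` at `g`. The underlying vector space of
`𝔤 = T₁G` is the model space of `G`. -/
def leftTrivialization (p : TangentBundle (𝓡 n) G) : EuclideanSpace ℝ (Fin n) :=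
  (leftTranslation p.1).symm p.2

lemma contMDiff_leftTrivialization :
    ContMDiff (𝓡 n).tangent 𝓘(ℝ, EuclideanSpace ℝ (Fin n)) ∞
      (leftTrivialization (n := n) (G := G)) := by
  let F₁ : TangentBundle (𝓡 n) G → TangentBundle (𝓡 n) G × TangentBundle (𝓡 n) G :=
    fun p ↦ (TotalSpace.mk' (EuclideanSpace ℝ (Fin n)) p.1⁻¹ 0, p)
  have hp : ContMDiff (𝓡 n).tangent (𝓡 n) ∞ (fun p : TangentBundle (𝓡 n) G ↦ p.1) :=
    contMDiff_proj _
  have S₀ : ContMDiff (𝓡 n) (𝓡 n).tangent ∞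
    (fun g : G ↦ (TotalSpace.mk' (EuclideanSpace ℝ (Fin n)) g 0 : TangentBundle (𝓡 n) G)) := 
    contMDiff_zeroSection _ _
  have S₁ : ContMDiff (𝓡 n).tangent ((𝓡 n).tangent.prod (𝓡 n).tangent) ∞ F₁ :=
    (S₀.comp (hp.inv)).prodMk contMDiff_id
  let F₂ : (TangentBundle (𝓡 n) G × TangentBundle (𝓡 n) G) → TangentBundle ((𝓡 n).prod (𝓡 n)) (G × G) :=
    (equivTangentBundleProd (𝓡 n) G (𝓡 n) G).symm
  have S₂ : ContMDiff ((𝓡 n).tangent.prod (𝓡 n).tangent) ((𝓡 n).prod (𝓡 n)).tangent ∞ F₂ :=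
    contMDiff_equivTangentBundleProd_symm
  let F₃ : TangentBundle ((𝓡 n).prod (𝓡 n)) (G × G) → TangentBundle (𝓡 n) G :=
    tangentMap ((𝓡 n).prod (𝓡 n)) (𝓡 n) (fun (p : G × G) ↦ p.1 * p.2)
  have S₃ : ContMDiff ((𝓡 n).prod (𝓡 n)).tangent (𝓡 n).tangent ∞ F₃ := by
    apply ContMDiff.contMDiff_tangentMap (n := ∞) (contMDiff_mul (𝓡 n) ∞)
    simp
  have S := (S₃.comp S₂).comp S₁
  have key : ((F₃ ∘ F₂) ∘ F₁) = fun p ↦ (TotalSpace.mk' (EuclideanSpace ℝ (Fin n)) (1 : G) ((leftTranslation p.1).symm p.2)) := by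
    funext p
    have : ((F₃ ∘ F₂) ∘ F₁) p = TotalSpace.mk' (EuclideanSpace ℝ (Fin n)) (p.1⁻¹ * p.1) ((leftTranslation p.1).symm p.2) := by
      simp only [Function.comp_apply, tangentMap, F₃, F₂, F₁]
      rw [mfderiv_prod_eq_add_apply ((contMDiff_mul (𝓡 n) ∞).mdifferentiableAt (by simp))]
      refine congrArg (TotalSpace.mk' (EuclideanSpace ℝ (Fin n)) (p.1⁻¹ * p.1)) ?_
      refine (congrArg₂ (· + ·) (ContinuousLinearMap.map_zero _) rfl).trans (zero_add _)
    rw [this]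
    have aux : ∀ (k : G) (hk : k = 1) (w : EuclideanSpace ℝ (Fin n)),
      (TotalSpace.mk' (EuclideanSpace ℝ (Fin n)) k w : TangentBundle (𝓡 n) G) = TotalSpace.mk' (EuclideanSpace ℝ (Fin n)) 1 w := by
      intro k hk w; subst hk; rfl
    exact aux _ (inv_mul_cancel _) _
  rw [key] at S
  intro p
  have := (contMDiffAt_totalSpace.1 (S p)).2
  refine this.congr_of_eventuallyEq (Filter.Eventually.of_forall fun q ↦ ?_)
  have h2 := (tangentBundleCore (𝓡 n) G).coordChange_self (achart _ (1 : G)) 1 (mem_chart_source _ _) ((leftTranslation q.1).symm q.2)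
  exact h2.symm

end LieGroup

/-! ### The flat connection for which left-invariant vector fields are parallel -/

section AmbientConnection

variable {n : ℕ} {G : Type*} [TopologicalSpace G] [ChartedSpace (EuclideanSpace ℝ (Fin n)) G]
  [Group G] [LieGroup (𝓡 n) ∞ G]
  {m : ℕ} {M : Type*} [TopologicalSpace M] [ChartedSpace (EuclideanSpace ℝ (Fin m)) M]

/-- The coordinates `M → 𝔤`, with respect to the left-invariant frames of `TG`, of a vector field
`Y` along a map `φ : M → G`. -/
def leftCoord (φ : M → G) (Y : Π x : M, TangentSpace (𝓡 n) (φ x)) (x : M) :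
    EuclideanSpace ℝ (Fin n) :=
  leftTrivialization ⟨φ x, Y x⟩

/-- The connection `∇̄` on `TG` determined by `∇̄ e = 0` for all left-invariant vector fields `e`,
acting on vector fields `Y` along a map `φ : M → G`: if `e₁, …, eₙ` is a basis of `𝔤` and
`Y = ∑ⱼ Yʲ eⱼ`, then `∇̄_v Y = ∑ⱼ dYʲ(v) eⱼ`. Here `ambientDeriv φ Y x v` is `(∇̄_v Y)(x)`. -/
def ambientDeriv (φ : M → G) (Y : Π x : M, TangentSpace (𝓡 n) (φ x)) (x : M) :
    TangentSpace (𝓡 m) x →L[ℝ] TangentSpace (𝓡 n) (φ x) :=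
  (leftTranslation (n := n) (φ x)).toContinuousLinearMap.comp
    (mvfderiv (𝓡 m) (leftCoord φ Y) x :
      TangentSpace (𝓡 m) x →L[ℝ] EuclideanSpace ℝ (Fin n))

lemma ambientDeriv_leftInvariant (φ : M → G) (v : GroupLieAlgebra (𝓡 n) G) (x : M) :
    ambientDeriv (m := m) φ (fun y ↦ mulInvariantVectorField v (φ y)) x = 0 := by
  obtain ⟨c, h⟩ : ∃ c : EuclideanSpace ℝ (Fin n),
      leftCoord φ (fun y ↦ mulInvariantVectorField v (φ y)) = fun _ ↦ c :=
    ⟨v, funext fun y ↦ (leftTranslation (φ y)).symm_apply_apply v⟩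
  ext w
  rw [ambientDeriv, h, mvfderiv_const]
  exact (leftTranslation (n := n) (φ x)).map_zero

lemma ambientDeriv_add (φ : M → G) {Y Y' : Π x : M, TangentSpace (𝓡 n) (φ x)} {x : M}
    (hY : MDifferentiableAt (𝓡 m) 𝓘(ℝ, EuclideanSpace ℝ (Fin n)) (leftCoord φ Y) x)
    (hY' : MDifferentiableAt (𝓡 m) 𝓘(ℝ, EuclideanSpace ℝ (Fin n)) (leftCoord φ Y') x) :
    ambientDeriv (m := m) φ (Y + Y') x = ambientDeriv φ Y x + ambientDeriv φ Y' x := by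
  have h : leftCoord φ (Y + Y') = leftCoord φ Y + leftCoord φ Y' :=
    funext fun y ↦ (leftTranslation (φ y)).symm.map_add _ _
  ext w
  rw [ambientDeriv, h, mvfderiv_add hY hY']
  exact (leftTranslation (n := n) (φ x)).map_add _ _

lemma ambientDeriv_smul (φ : M → G) {Y : Π x : M, TangentSpace (𝓡 n) (φ x)} {f : M → ℝ} {x : M}
    (hY : MDifferentiableAt (𝓡 m) 𝓘(ℝ, EuclideanSpace ℝ (Fin n)) (leftCoord φ Y) x)
    (hf : MDifferentiableAt (𝓡 m) 𝓘(ℝ, ℝ) f x) :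
    ambientDeriv (m := m) φ (f • Y) x =
      f x • ambientDeriv φ Y x + (mvfderiv (𝓡 m) f x).smulRight (Y x) := by
  have h : leftCoord φ (f • Y) = f • leftCoord φ Y :=
    funext fun y ↦ (leftTranslation (φ y)).symm.map_smul _ _
  ext w
  rw [ambientDeriv, h, mvfderiv_smul hf hY]
  refine ((leftTranslation (n := n) (φ x)).map_add _ _).trans ?_
  refine congrArg₂ (· + ·) ((leftTranslation (n := n) (φ x)).map_smul _ _) ?_
  refine ((leftTranslation (n := n) (φ x)).map_smul _ _).trans ?_
  exact congrArg _ ((leftTranslation (n := n) (φ x)).apply_symm_apply _)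

end AmbientConnection

/-! ### Stratified Lie groups -/

section Stratified

variable (n : ℕ) (G : Type*) [TopologicalSpace G] [ChartedSpace (EuclideanSpace ℝ (Fin n)) G]
  [Group G] [LieGroup (𝓡 n) ∞ G]

/-- A stratification `𝔤 = 𝔤¹ ⊕ ⋯ ⊕ 𝔤ʳ` (`r = step`, `𝔤ʲ = layer j`) of the Lie algebra of `G`, with
`[𝔤¹, 𝔤ʲ] = 𝔤ʲ⁺¹` for `1 ≤ j < r` and `[𝔤ʲ, 𝔤ʳ] = 0` for `1 ≤ j ≤ r`, together with a positive
definite scalar product on `𝔤¹`. -/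
structure Stratification where
  step : ℕ
  one_le_step : 1 ≤ step
  layer : ℕ → Submodule ℝ (GroupLieAlgebra (𝓡 n) G)
  layer_eq_bot : ∀ j, j ∉ Finset.Icc 1 step → layer j = ⊥
  isInternal : DirectSum.IsInternal layer
  span_bracket : ∀ j, 1 ≤ j → j < step →
    Submodule.span ℝ {z | ∃ v ∈ layer 1, ∃ w ∈ layer j, ⁅v, w⁆ = z} = layer (j + 1)
  bracket_top : ∀ j, 1 ≤ j → j ≤ step → ∀ v ∈ layer j, ∀ w ∈ layer step, ⁅v, w⁆ = 0
  scalarProduct : LinearMap.BilinForm ℝ (layer 1)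
  isSymm : scalarProduct.IsSymm
  posDef : ∀ v : layer 1, v ≠ 0 → 0 < scalarProduct v v

variable {n G}

namespace Stratification

variable (𝔖 : Stratification n G)

/-- The left-invariant horizontal distribution `D ⊆ TG` generated by `𝔤¹`. -/
def horizontal (g : G) : Submodule ℝ (TangentSpace (𝓡 n) g) :=
  (𝔖.layer 1).map (leftTranslation g).toLinearEquiv.toLinearMap

/-- Left translation identifies `𝔤¹` with `D_g`. -/
def horizontalEquiv (g : G) : 𝔖.layer 1 ≃ₗ[ℝ] 𝔖.horizontal g :=
  (leftTranslation g).toLinearEquiv.submoduleMap (𝔖.layer 1)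

/-- The left-invariant sub-Riemannian metric on `D`. -/
def metric (g : G) : LinearMap.BilinForm ℝ (𝔖.horizontal g) :=
  𝔖.scalarProduct.compl₁₂ (𝔖.horizontalEquiv g).symm.toLinearMap
    (𝔖.horizontalEquiv g).symm.toLinearMap

lemma metric_isSymm (g : G) : (𝔖.metric g).IsSymm :=
  ⟨fun _ _ ↦ 𝔖.isSymm.eq _ _⟩

lemma metric_posDef (g : G) (v : 𝔖.horizontal g) (hv : v ≠ 0) : 0 < 𝔖.metric g v v :=
  𝔖.posDef _ (by simpa using hv)

end Stratification

instance (g : G) : FiniteDimensional ℝ (TangentSpace (𝓡 n) g) :=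
  inferInstanceAs (FiniteDimensional ℝ (EuclideanSpace ℝ (Fin n)))

instance (g : G) : T2Space (TangentSpace (𝓡 n) g) :=
  inferInstanceAs (T2Space (EuclideanSpace ℝ (Fin n)))

end Stratified

/-! ### Non-horizontal submanifolds -/

section Submanifold

variable {n : ℕ} {G : Type*} [TopologicalSpace G] [ChartedSpace (EuclideanSpace ℝ (Fin n)) G]
  [Group G] [LieGroup (𝓡 n) ∞ G]
  {m : ℕ} {M : Type*} [TopologicalSpace M] [ChartedSpace (EuclideanSpace ℝ (Fin m)) M]

/-- `X` is a smooth tangent vector field on the subset `U` of `M`. -/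
def SmoothTangentField [IsManifold (𝓡 m) ∞ M] (U : Set M) (X : Π x : M, TangentSpace (𝓡 m) x) : Prop :=
  ContMDiffOn (𝓡 m) (𝓡 m).tangent ∞ (fun x ↦ (⟨x, X x⟩ : TangentBundle (𝓡 m) M)) U

/-- `M` as an immersed submanifold of `G` that is non-horizontal: `TM + D = TG` along `M`. -/
structure NonHorizontalSubmanifold (𝔖 : Stratification n G) (m : ℕ) (M : Type*)
    [TopologicalSpace M] [ChartedSpace (EuclideanSpace ℝ (Fin m)) M] where
  incl : M → G
  contMDiff_incl : ContMDiff (𝓡 m) (𝓡 n) ∞ incl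
  injective_mfderiv : ∀ x, Function.Injective (mfderiv (𝓡 m) (𝓡 n) incl x)
  transverse : ∀ x,
    LinearMap.range (mfderiv (𝓡 m) (𝓡 n) incl x).toLinearMap ⊔ 𝔖.horizontal (incl x) = ⊤

namespace NonHorizontalSubmanifold

variable {𝔖 : Stratification n G} (N : NonHorizontalSubmanifold 𝔖 m M)

/-- `T_xM` as a subspace of `T_xG`. -/
def tangent (x : M) : Submodule ℝ (TangentSpace (𝓡 n) (N.incl x)) :=
  LinearMap.range (mfderiv (𝓡 m) (𝓡 n) N.incl x).toLinearMap

/-- `T_xM^⊥`: the orthogonal complement, inside `D` and for the metric of `D`, of `TM ∩ D`. -/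
def normal (x : M) : Submodule ℝ (TangentSpace (𝓡 n) (N.incl x)) :=
  ((𝔖.metric (N.incl x)).orthogonal
    ((N.tangent x).comap (𝔖.horizontal (N.incl x)).subtype)).map
      (𝔖.horizontal (N.incl x)).subtype

/-- The splitting `TG = TM ⊕ TM^⊥` along `M`. -/
lemma isCompl (x : M) : IsCompl (N.tangent x) (N.normal x) := by
  set D := 𝔖.horizontal (N.incl x) with hD
  set B := 𝔖.metric (N.incl x) with hB
  set W := (N.tangent x).comap D.subtype with hW
  have hdis : Disjoint W (B.orthogonal W) := by
    rw [Submodule.disjoint_def]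
    intro v hv hv'
    by_contra h
    exact (𝔖.metric_posDef _ v h).ne' (hv' v hv)
  have hc : IsCompl W (B.orthogonal W) :=
    (LinearMap.BilinForm.isCompl_orthogonal_iff_disjoint (𝔖.metric_isSymm _).isRefl).2 hdis
  constructor
  · rw [Submodule.disjoint_def]
    rintro v hv ⟨d, hd, rfl⟩
    have : d = 0 := (Submodule.disjoint_def.1 hdis) d hv hd
    simp [this]
  · rw [codisjoint_iff, eq_top_iff, ← N.transverse x]
    refine sup_le le_sup_left ?_
    have h1 : D = (W ⊔ B.orthogonal W).map D.subtype := by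
      rw [hc.sup_eq_top, Submodule.map_top, Submodule.range_subtype]
    rw [← hD, h1, Submodule.map_sup]
    exact sup_le_sup (Submodule.map_comap_le _ _) le_rfl

/-- The differential of the inclusion, as an isomorphism of `T_xM` with its image in `T_xG`. -/
def tangentEquiv (x : M) : TangentSpace (𝓡 m) x ≃ₗ[ℝ] N.tangent x :=
  LinearEquiv.ofInjective (mfderiv (𝓡 m) (𝓡 n) N.incl x).toLinearMap (N.injective_mfderiv x)

/-- The tangential part `v ↦ v^⊤` in the splitting `TG = TM ⊕ TM^⊥`, as an element of `T_xM`. -/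
def tangentialPart (x : M) : TangentSpace (𝓡 n) (N.incl x) →L[ℝ] TangentSpace (𝓡 m) x :=
  LinearMap.toContinuousLinearMap
    ((N.tangentEquiv x).symm.toLinearMap ∘ₗ
      (N.tangent x).projectionOnto (N.normal x) (N.isCompl x))

/-- The normal part `v ↦ v^⊥` in the splitting `TG = TM ⊕ TM^⊥`. -/
def normalPart (x : M) : TangentSpace (𝓡 n) (N.incl x) →L[ℝ] N.normal x :=
  LinearMap.toContinuousLinearMap
    ((N.normal x).projectionOnto (N.tangent x) (N.isCompl x).symm)

/-- A vector field on `M`, regarded as a vector field of `TG` along `M`. -/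
def push (Y : Π x : M, TangentSpace (𝓡 m) x) (x : M) : TangentSpace (𝓡 n) (N.incl x) :=
  mfderiv (𝓡 m) (𝓡 n) N.incl x (Y x)

lemma tangentialPart_push (Y : Π x : M, TangentSpace (𝓡 m) x) (x : M) :
    N.tangentialPart x (N.push Y x) = Y x := by
  have h : N.push Y x = (N.tangentEquiv x (Y x) : TangentSpace (𝓡 n) (N.incl x)) := rfl
  rw [h, tangentialPart, LinearMap.coe_toContinuousLinearMap', LinearMap.comp_apply,
    Submodule.projectionOnto_apply_left]
  exact (N.tangentEquiv x).symm_apply_apply _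

lemma push_tangentialPart_add_normalPart (x : M) (v : TangentSpace (𝓡 n) (N.incl x)) :
    mfderiv (𝓡 m) (𝓡 n) N.incl x (N.tangentialPart x v) + N.normalPart x v = v := by
  have h : mfderiv (𝓡 m) (𝓡 n) N.incl x (N.tangentialPart x v) =
      ((N.tangent x).projectionOnto (N.normal x) (N.isCompl x) v :
        TangentSpace (𝓡 n) (N.incl x)) :=
    congrArg Subtype.val ((N.tangentEquiv x).apply_symm_apply _)
  rw [h]
  exact Submodule.projection_add_projection_eq_self (N.isCompl x) v

section

variable [IsManifold (𝓡 m) ∞ M]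

lemma mdifferentiableAt_leftCoord_push {Y : Π x : M, TangentSpace (𝓡 m) x} {x : M}
    (hY : MDifferentiableAt (𝓡 m) (𝓡 m).tangent
      (fun y ↦ (⟨y, Y y⟩ : TangentBundle (𝓡 m) M)) x) :
    MDifferentiableAt (𝓡 m) 𝓘(ℝ, EuclideanSpace ℝ (Fin n)) (leftCoord N.incl (N.push Y)) x := by
  have h1 : ContMDiff (𝓡 m).tangent (𝓡 n).tangent ∞ (tangentMap (𝓡 m) (𝓡 n) N.incl) :=
    N.contMDiff_incl.contMDiff_tangentMap (by simp)
  have h2 := contMDiff_leftTrivialization.comp h1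
  have h3 : MDifferentiable (𝓡 m).tangent 𝓘(ℝ, EuclideanSpace ℝ (Fin n))
      (leftTrivialization ∘ tangentMap (𝓡 m) (𝓡 n) N.incl) := h2.mdifferentiable (by simp)
  have h4 := (h3 ⟨x, Y x⟩).comp x hY
  exact h4

/-- The connection `∇_X Y = (∇̄_X Y)^⊤` induced on `TM`; `N.connection Y x v` is `(∇_v Y)(x)`. -/
def connection : CovariantDerivative (𝓡 m) (EuclideanSpace ℝ (Fin m))
    (TangentSpace (𝓡 m) : M → Type _) where
  toFun Y x := (N.tangentialPart x).comp (ambientDeriv N.incl (N.push Y) x)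
  isCovariantDerivativeOnUniv :=
    { add := by
        intro Y Y' x hY hY' _
        have h : N.push (Y + Y') = N.push Y + N.push Y' :=
          funext fun y ↦ (mfderiv (𝓡 m) (𝓡 n) N.incl y).map_add _ _
        rw [h, ambientDeriv_add _ (N.mdifferentiableAt_leftCoord_push hY)
          (N.mdifferentiableAt_leftCoord_push hY'), ContinuousLinearMap.comp_add]
      leibniz := by
        intro Y f x hY hf _
        have h : N.push (f • Y) = f • N.push Y :=
          funext fun y ↦ (mfderiv (𝓡 m) (𝓡 n) N.incl y).map_smul _ _
        rw [h, ambientDeriv_smul _ (N.mdifferentiableAt_leftCoord_push hY) hf]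
        ext v
        simp [tangentialPart_push] }

/-- `∇_X Y`. -/
def nabla (X Y : Π x : M, TangentSpace (𝓡 m) x) (x : M) : TangentSpace (𝓡 m) x :=
  N.connection Y x (X x)

/-- The torsion `T(X, Y) = ∇_X Y - ∇_Y X - [X, Y]` of `∇`. -/
def torsion (X Y : Π x : M, TangentSpace (𝓡 m) x) (x : M) : TangentSpace (𝓡 m) x :=
  N.connection.torsion x (X x) (Y x)

end

/-- The second fundamental form `S(X, Y) = (∇̄_X Y)^⊥`. -/
def secondFundamentalForm (X Y : Π x : M, TangentSpace (𝓡 m) x) (x : M) : N.normal x :=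
  N.normalPart x (ambientDeriv N.incl (N.push Y) x (X x))

/-- The Weingarten operator `A_ξ(X) = -(∇̄_X ξ)^⊤`. -/
def weingarten (ξ : Π x : M, N.normal x) (X : Π x : M, TangentSpace (𝓡 m) x) (x : M) :
    TangentSpace (𝓡 m) x :=
  -N.tangentialPart x (ambientDeriv N.incl (fun y ↦ (ξ y : TangentSpace (𝓡 n) (N.incl y))) x (X x))

/-- The normal connection `∇^⊥_X ξ = (∇̄_X ξ)^⊥` on `TM^⊥`. -/
def normalNabla (X : Π x : M, TangentSpace (𝓡 m) x) (ξ : Π x : M, N.normal x) (x : M) :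
    N.normal x :=
  N.normalPart x (ambientDeriv N.incl (fun y ↦ (ξ y : TangentSpace (𝓡 n) (N.incl y))) x (X x))

/-- The curvature `K(X, Y)Z = ∇_X ∇_Y Z - ∇_Y ∇_X Z - ∇_{[X, Y]} Z` of `∇`. -/
def curvature [IsManifold (𝓡 m) ∞ M] (X Y Z : Π x : M, TangentSpace (𝓡 m) x) :
    Π x : M, TangentSpace (𝓡 m) x :=
  N.nabla X (N.nabla Y Z) - N.nabla Y (N.nabla X Z) -
    N.nabla (VectorField.mlieBracket (𝓡 m) X Y) Z

/-- The curvature `K^⊥(X, Y)ξ = ∇^⊥_X ∇^⊥_Y ξ - ∇^⊥_Y ∇^⊥_X ξ - ∇^⊥_{[X, Y]} ξ` of `∇^⊥`. -/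
def normalCurvature (X Y : Π x : M, TangentSpace (𝓡 m) x) (ξ : Π x : M, N.normal x) :
    Π x : M, N.normal x :=
  N.normalNabla X (N.normalNabla Y ξ) - N.normalNabla Y (N.normalNabla X ξ) -
    N.normalNabla (VectorField.mlieBracket (𝓡 m) X Y) ξ

/-- `(∇̃_X S)(Y, Z) = ∇^⊥_X (S(Y, Z)) - S(∇_X Y, Z) - S(Y, ∇_X Z)`. -/
def derivSecondFundamentalForm [IsManifold (𝓡 m) ∞ M] (X Y Z : Π x : M, TangentSpace (𝓡 m) x) :
    Π x : M, N.normal x :=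
  N.normalNabla X (N.secondFundamentalForm Y Z) - N.secondFundamentalForm (N.nabla X Y) Z -
    N.secondFundamentalForm Y (N.nabla X Z)

/-- `ξ` is a smooth section of `TM^⊥` on the subset `U` of `M`. -/
def SmoothNormalField (U : Set M) (ξ : Π x : M, N.normal x) : Prop :=
  ContMDiffOn (𝓡 m) (𝓡 n).tangent ∞
    (fun x ↦ (⟨N.incl x, (ξ x : TangentSpace (𝓡 n) (N.incl x))⟩ : TangentBundle (𝓡 n) G)) U

end NonHorizontalSubmanifold

end Submanifold

end SubRiemannian

end

/-! In left-invariant frames a vector field along `M` is a function with values in the fixed vector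
space `𝔤`, and `∇̄` is its ordinary derivative. Hence `∇̄` is flat: `∇̄_X ∇̄_Y V - ∇̄_Y ∇̄_X V =
∇̄_{[X,Y]} V` is the identity `X(Y f) - Y(X f) = [X, Y] f` for vector-valued `f`
(`mvfderiv_mlieBracket`). Split the inner derivatives into their `TM` and `TM^⊥` parts,
differentiate again, and project. For `V = Z` the tangential component is Gauss and the normal one
is Codazzi, the torsion entering through `[X, Y] = ∇_X Y - ∇_Y X - T(X, Y)`; for `V = ξ` the normal
component is Ricci.

The analytic content is that the two parts of a differentiable field are again differentiable,
without which the derivative of their sum cannot be split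
(`mdifferentiableAt_leftCoord_push_tangentialPart`). The splitting is defined fibre by fibre through
`TM ∩ D`. Instead of a local frame of that intersection, the proof obtains the tangential part from
a square linear system whose coefficients depend differentiably on the point; transversality makes
it invertible (`isInvertible_splittingSystem`), and operator inversion is smooth. -/

open scoped Manifold ContDiff

noncomputable section

namespace SubRiemannian

open VectorField Set Filter Bundle
open scoped Topology

/-! ### Directional derivatives of vector-valued functions and the Lie bracket -/

section DirectionalDerivative

variable {E : Type*} [NormedAddCommGroup E] [NormedSpace ℝ E]
  {H : Type*} [TopologicalSpace H] {I : ModelWithCorners ℝ E H}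
  {M : Type*} [TopologicalSpace M] [ChartedSpace H M]
  {F : Type*} [NormedAddCommGroup F] [NormedSpace ℝ F]
  {f : M → F} {V W : Π x : M, TangentSpace I x} {x : M}

/-- The coordinate expression, in the chart at `x`, of the vector field `V`. -/
def chartField (I : ModelWithCorners ℝ E H) (x : M) (V : Π x : M, TangentSpace I x) : E → E :=
  mpullbackWithin 𝓘(ℝ, E) I (extChartAt I x).symm V (range I)

/-- The tangent space at `x` is the model space as seen in the chart at `x`, so the differential of
that chart at `x` is the identity. -/
lemma chartField_self [IsManifold I 1 M] : chartField I x V (extChartAt I x x) = V x := by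
  have h : ∀ y (_ : y = x), (show E from V y) = V x := by rintro _ rfl; rfl
  exact (mfderivWithin_extChartAt_symm_inverse_apply (I := I) (x := x) _).trans
    (h _ (extChartAt_to_inv (I := I) x))

variable [I.Boundaryless]

lemma differentiableAt_chartField [CompleteSpace E] [IsManifold I 2 M]
    (hV : MDifferentiableAt I I.tangent (fun y ↦ (⟨y, V y⟩ : TangentBundle I M)) x) :
    DifferentiableAt ℝ (chartField I x V) (extChartAt I x x) := by
  rw [← mdifferentiableWithinAt_univ] at hV
  have h := hV.differentiableWithinAt_mpullbackWithin_vectorField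
  rw [preimage_univ, univ_inter] at h
  exact h.differentiableAt (by simp [I.range_eq_univ])

lemma mlieBracket_eq_lieBracket_chartField [CompleteSpace E] [IsManifold I 1 M] :
    mlieBracket I V W x =
      lieBracket ℝ (chartField I x V) (chartField I x W) (extChartAt I x x) := by
  have h (v : E) : (mfderiv I 𝓘(ℝ, E) (extChartAt I x) x).inverse v = v := by
    rw [mfderiv_extChartAt_self]
    exact congrArg (fun L : E →L[ℝ] E ↦ L v) ContinuousLinearMap.inverse_id
  rw [← mlieBracketWithin_univ, mlieBracketWithin_apply]
  refine (h _).trans ?_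
  rw [preimage_univ, univ_inter, ← lieBracketWithin_univ, ← I.range_eq_univ]
  rfl

lemma mvfderiv_apply_chart [IsManifold I 1 M] {u : E} (hu : u ∈ (extChartAt I x).target)
    (hf : MDifferentiableAt I 𝓘(ℝ, F) f ((extChartAt I x).symm u)) :
    mvfderiv I f ((extChartAt I x).symm u) (V ((extChartAt I x).symm u)) =
      fderiv ℝ (f ∘ (extChartAt I x).symm) u (chartField I x V u) := by
  have hs := mdifferentiableWithinAt_extChartAt_symm (I := I) hu
  have h1 := isInvertible_mfderivWithin_extChartAt_symm (I := I) hu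
  rw [← mfderiv_eq_fderiv, chartField, mpullbackWithin_apply]
  rw [I.range_eq_univ, mdifferentiableWithinAt_univ] at hs
  rw [I.range_eq_univ, mfderivWithin_univ] at h1 ⊢
  rw [mfderiv_comp u hf hs]
  exact (congrArg (mvfderiv I f ((extChartAt I x).symm u)) (h1.self_apply_inverse _)).symm

/-- Agreement near the base point, and not only at it, is what allows both sides to be
differentiated once more. -/
lemma mvfderiv_apply_comp_chart_eventuallyEq [IsManifold I 1 M]
    (hf : ContMDiffAt I 𝓘(ℝ, F) 1 f x) :
    (fun y ↦ mvfderiv I f y (V y)) ∘ (extChartAt I x).symm =ᶠ[𝓝 (extChartAt I x x)]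
      fun u ↦ fderiv ℝ (f ∘ (extChartAt I x).symm) u (chartField I x V u) := by
  have h1 : ∀ᶠ y in 𝓝 x, ContMDiffAt I 𝓘(ℝ, F) 1 f y :=
    contMDiffAt_iff_contMDiffAt_nhds (by simp) |>.1 hf
  have h2 : Tendsto (extChartAt I x).symm (𝓝 (extChartAt I x x)) (𝓝 x) := by
    simpa [ContinuousAt] using continuousAt_extChartAt_symm (I := I) x
  filter_upwards [h2.eventually h1, extChartAt_target_mem_nhds (I := I) x] with u hu hu'
  exact mvfderiv_apply_chart hu' (hu.mdifferentiableAt one_ne_zero)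

lemma contDiffAt_comp_extChartAt_symm [IsManifold I 2 M] (hf : ContMDiffAt I 𝓘(ℝ, F) 2 f x) :
    ContDiffAt ℝ 2 (f ∘ (extChartAt I x).symm) (extChartAt I x x) := by
  have h := (contMDiffAt_iff.1 hf).2
  rwa [I.range_eq_univ, contDiffWithinAt_univ] at h

lemma mdifferentiableAt_mvfderiv_apply [CompleteSpace E] [IsManifold I 2 M]
    (hf : ContMDiffAt I 𝓘(ℝ, F) 2 f x)
    (hV : MDifferentiableAt I I.tangent (fun y ↦ (⟨y, V y⟩ : TangentBundle I M)) x) :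
    MDifferentiableAt I 𝓘(ℝ, F) (fun y ↦ mvfderiv I f y (V y)) x := by
  have : IsManifold I 1 M := IsManifold.of_le (n := 2) (by norm_num)
  have h1 := ((contDiffAt_comp_extChartAt_symm hf).fderiv_right (m := 1)
    (by norm_num)).differentiableAt one_ne_zero
  have h2 := h1.clm_apply (differentiableAt_chartField hV)
  have h3 := h2.congr_of_eventuallyEq
    (mvfderiv_apply_comp_chart_eventuallyEq (V := V) (hf.of_le one_le_two))
  have h4 : MDifferentiableAt I 𝓘(ℝ, F) (((fun y ↦ mvfderiv I f y (V y)) ∘ (extChartAt I x).symm) ∘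
      extChartAt I x) x :=
    h3.mdifferentiableAt.comp x (mdifferentiableAt_extChartAt (mem_chart_source H x))
  refine h4.congr_of_eventuallyEq ?_
  filter_upwards [extChartAt_source_mem_nhds (I := I) x] with y hy
  simp only [Function.comp_apply]
  rw [(extChartAt I x).left_inv hy]

/-- `V(W f) - W(V f) = [V, W] f`. -/
lemma mvfderiv_mlieBracket [CompleteSpace E] [IsManifold I 2 M]
    (hf : ContMDiffAt I 𝓘(ℝ, F) 2 f x)
    (hV : MDifferentiableAt I I.tangent (fun y ↦ (⟨y, V y⟩ : TangentBundle I M)) x)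
    (hW : MDifferentiableAt I I.tangent (fun y ↦ (⟨y, W y⟩ : TangentBundle I M)) x) :
    mvfderiv I f x (mlieBracket I V W x) =
      mvfderiv I (fun y ↦ mvfderiv I f y (W y)) x (V x) -
        mvfderiv I (fun y ↦ mvfderiv I f y (V y)) x (W x) := by
  have : IsManifold I 1 M := IsManifold.of_le (n := 2) (by norm_num)
  -- At the centre of the chart the coordinate field has the value of the field itself, so no chart
  -- differential is left over.
  have key : ∀ (g : M → F) (U : Π x : M, TangentSpace I x), MDifferentiableAt I 𝓘(ℝ, F) g x →
      mvfderiv I g x (U x) = fderiv ℝ (g ∘ (extChartAt I x).symm) (extChartAt I x x) (U x) := by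
    intro g U hg
    have h := mvfderiv_apply_chart (V := U) (mem_extChartAt_target (I := I) x)
      (by rwa [extChartAt_to_inv])
    rw [chartField_self] at h
    rw [← h, extChartAt_to_inv x]
  have hf2 := contDiffAt_comp_extChartAt_symm hf
  rw [key _ _ (mdifferentiableAt_mvfderiv_apply hf hV),
    key _ _ (mdifferentiableAt_mvfderiv_apply hf hW),
    key _ _ (hf.mdifferentiableAt two_ne_zero), mlieBracket_eq_lieBracket_chartField,
    (mvfderiv_apply_comp_chart_eventuallyEq (V := V) (hf.of_le one_le_two)).fderiv_eq,
    (mvfderiv_apply_comp_chart_eventuallyEq (V := W) (hf.of_le one_le_two)).fderiv_eq,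
    ← chartField_self (V := V), ← chartField_self (V := W)]
  exact fderiv_apply_lieBracket hf2 (by simp) (differentiableAt_chartField hW)
    (differentiableAt_chartField hV)

end DirectionalDerivative

/-! ### The splitting as the solution of a linear system -/

section LinearAlgebra

/-- A scalar product `s` on a subspace `D` extends to an ambient positive definite bilinear form
`b` such that `D` is the image of a `b`-orthogonal projection `P`. -/
lemma exists_projection_and_extension {F : Type*} [NormedAddCommGroup F] [InnerProductSpace ℝ F]
    [FiniteDimensional ℝ F] (D : Submodule ℝ F) (s : LinearMap.BilinForm ℝ D)
    (hs : ∀ v : D, v ≠ 0 → 0 < s v v) :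
    ∃ (P : F →L[ℝ] F) (b : F →L[ℝ] F →L[ℝ] ℝ), (∀ u, P u ∈ D) ∧
      (∀ u, ∀ d ∈ D, b u d = b (P u) d) ∧ (∀ d e : D, b d e = s d e) ∧
      (∀ u, u ≠ 0 → 0 < b u u) := by
  obtain ⟨D', hD⟩ := D.exists_isCompl
  let p : F →ₗ[ℝ] D := D.projectionOnto D' hD
  let q : F →ₗ[ℝ] F := LinearMap.id - D.subtype ∘ₗ p
  -- The form is `s` on `D` and the ambient inner product on the complement `D'`, the two being
  -- declared orthogonal.
  let b : F →ₗ[ℝ] F →ₗ[ℝ] ℝ := s.compl₁₂ p p + (innerₗ F).compl₁₂ q q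
  have hp : ∀ d : D, p d = d := fun d ↦ Submodule.projectionOnto_apply_left hD d
  have hq : ∀ d : D, q d = 0 := fun d ↦ by simp [q, hp]
  have hb : ∀ u v, b u v = s (p u) (p v) + inner ℝ (q u) (q v) := fun _ _ ↦ rfl
  refine ⟨LinearMap.toContinuousLinearMap (D.subtype ∘ₗ p), b.toContinuousBilinearMap,
    fun u ↦ (p u).2, fun u d hd ↦ ?_, fun d e ↦ ?_, fun u hu ↦ ?_⟩
  · lift d to D using hd
    simp [hb, hp, hq]
  · simp [hb, hp, hq]
  · rw [LinearMap.toContinuousBilinearMap_apply, hb]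
    by_cases h : p u = 0
    · have : q u = u := by simp [q, h]
      rw [h, this]
      simpa using real_inner_self_pos.2 hu
    · exact add_pos_of_pos_of_nonneg (hs _ h) real_inner_self_nonneg

variable {E F : Type*} [NormedAddCommGroup E] [NormedSpace ℝ E] [NormedAddCommGroup F]
  [NormedSpace ℝ F]

/-- The linear system `A w + P u = v`, `b(u, A ·) = 0` in the unknown `(w, u)`, whose solution gives
the decomposition of `v` in `range A` and the `b`-orthogonal complement, in the range of `P`, of
`range A ∩ range P`. -/
def splittingSystem (P : F →L[ℝ] F) (b : F →L[ℝ] F →L[ℝ] ℝ) (A : E →L[ℝ] F) :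
    E × F →L[ℝ] F × (E →L[ℝ] ℝ) :=
  (A.comp (.fst ℝ E F) + P.comp (.snd ℝ E F)).prod
    (((ContinuousLinearMap.compL ℝ E F ℝ).flip A).comp (b.comp (.snd ℝ E F)))

lemma splittingSystem_apply (P : F →L[ℝ] F) (b : F →L[ℝ] F →L[ℝ] ℝ) (A : E →L[ℝ] F) (p : E × F) :
    splittingSystem P b A p = (A p.1 + P p.2, (b p.2).comp A) := rfl

/-- Both sides have dimension `dim E + dim F`, so injectivity suffices. To keep the system square,
`u` ranges over all of `F` and is tested against all of `range A`; since `b u d = b (P u) d` on `D`,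
this still makes `P u` orthogonal to `range A ∩ D`. -/
lemma isInvertible_splittingSystem [FiniteDimensional ℝ E] [FiniteDimensional ℝ F]
    {D : Submodule ℝ F} {P : F →L[ℝ] F} {b : F →L[ℝ] F →L[ℝ] ℝ} {A : E →L[ℝ] F}
    (hP : ∀ u, P u ∈ D) (hbP : ∀ u, ∀ d ∈ D, b u d = b (P u) d) (hb : ∀ u, u ≠ 0 → 0 < b u u)
    (hA : Function.Injective A) (hAD : LinearMap.range A.toLinearMap ⊔ D = ⊤) :
    (splittingSystem P b A).IsInvertible := by
  have hinj : Function.Injective (splittingSystem P b A) := by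
    rw [injective_iff_map_eq_zero]
    rintro ⟨w, u⟩ h
    rw [splittingSystem_apply, Prod.mk_eq_zero] at h
    obtain ⟨h1, h2⟩ := h
    have h2' : ∀ a, b u (A a) = 0 := fun a ↦ DFunLike.congr_fun h2 a
    -- `b(Pu, Pu) = b(u, Pu) = -b(u, Aw) = 0`.
    have hPu : P u = 0 := by
      by_contra hne
      refine (hb _ hne).ne' ?_
      rw [← hbP u _ (hP u), eq_neg_of_add_eq_zero_right h1, map_neg, h2', neg_zero]
    have hw : w = 0 := hA (by simpa [hPu] using h1)
    have hu : u = 0 := by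
      by_contra hne
      refine (hb _ hne).ne' ?_
      -- Transversality enters here: with `u = Aa + d`, `b(u, u) = b(u, Aa) + b(Pu, d) = 0`.
      obtain ⟨_, ⟨a, rfl⟩, d, hd, h⟩ := Submodule.mem_sup.1 (hAD ▸ Submodule.mem_top : u ∈ _)
      have h3 : b u (A a + d) = 0 := by
        rw [map_add, h2', hbP u d hd, hPu]
        simp
      rwa [show A a + d = u from h] at h3
    simp [hw, hu]
  have hdim : Module.finrank ℝ (E × F) = Module.finrank ℝ (F × (E →L[ℝ] ℝ)) := by
    rw [Module.finrank_prod, Module.finrank_prod, add_comm,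
      ← (LinearMap.toContinuousLinearMap : (E →ₗ[ℝ] ℝ) ≃ₗ[ℝ] _).finrank_eq,
      Module.finrank_linearMap_self]
  exact ⟨(LinearEquiv.ofInjectiveOfFinrankEq (splittingSystem P b A).toLinearMap hinj
    hdim).toContinuousLinearEquiv, by ext <;> rfl⟩

end LinearAlgebra

/-! ### Differentiable dependence of the system and its inverse on the point -/

section Manifold

variable {E : Type*} [NormedAddCommGroup E] [NormedSpace ℝ E]
  {H : Type*} [TopologicalSpace H] {I : ModelWithCorners ℝ E H}
  {M : Type*} [TopologicalSpace M] [ChartedSpace H M]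
  {F F' : Type*} [NormedAddCommGroup F] [NormedSpace ℝ F] [FiniteDimensional ℝ F]
  [NormedAddCommGroup F'] [NormedSpace ℝ F'] [FiniteDimensional ℝ F'] {x : M}

/-- In finite dimension an operator is a continuous linear function of its values on a basis. -/
lemma mdifferentiableAt_clm_of_apply {A : M → F →L[ℝ] F'}
    (hA : ∀ w, MDifferentiableAt I 𝓘(ℝ, F') (fun y ↦ A y w) x) :
    MDifferentiableAt I 𝓘(ℝ, F →L[ℝ] F') A x := by
  let v := Module.finBasis ℝ F
  let T : (Fin (Module.finrank ℝ F) → F') →L[ℝ] F →L[ℝ] F' := LinearMap.toContinuousLinearMap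
    ((LinearMap.toContinuousLinearMap : (F →ₗ[ℝ] F') ≃ₗ[ℝ] F →L[ℝ] F').toLinearMap ∘ₗ
      (v.constr ℝ).toLinearMap)
  have h : A = T ∘ fun y i ↦ A y (v i) := by
    funext y
    apply ContinuousLinearMap.coe_injective
    exact v.ext fun i ↦ (v.constr_basis ℝ (fun i ↦ A y (v i)) i).symm
  rw [h]
  refine T.differentiableAt.mdifferentiableAt.comp x ⟨?_, ?_⟩
  · exact continuousWithinAt_pi.2 fun i ↦ (hA (v i)).1
  · exact differentiableWithinAt_pi.2 fun i ↦ (hA (v i)).2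

lemma mdifferentiableAt_inverse_splittingSystem
    {P : F' →L[ℝ] F'} {b : F' →L[ℝ] F' →L[ℝ] ℝ} {A : M → F →L[ℝ] F'}
    (hA : MDifferentiableAt I 𝓘(ℝ, F →L[ℝ] F') A x)
    (h : (splittingSystem P b (A x)).IsInvertible) :
    MDifferentiableAt I 𝓘(ℝ, F' × (F →L[ℝ] ℝ) →L[ℝ] F × F')
      (fun y ↦ (splittingSystem P b (A y)).inverse) x := by
  obtain ⟨e, he⟩ := h
  have h1 : MDifferentiableAt 𝓘(ℝ, F × F' →L[ℝ] F' × (F →L[ℝ] ℝ))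
      𝓘(ℝ, F' × (F →L[ℝ] ℝ) →L[ℝ] F × F') ContinuousLinearMap.inverse
      (splittingSystem P b (A x)) := by
    rw [← he]
    exact (contDiffAt_map_inverse (n := 1) e).contMDiffAt.mdifferentiableAt one_ne_zero
  have h2 : MDifferentiableAt I 𝓘(ℝ, F × F' →L[ℝ] F' × (F →L[ℝ] ℝ))
      (fun y ↦ splittingSystem P b (A y)) x := by
    refine mdifferentiableAt_clm_of_apply fun p ↦ ?_
    have hAp (w : F) : MDifferentiableAt I 𝓘(ℝ, F') (fun y ↦ A y w) x :=
      hA.clm_apply mdifferentiableAt_const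
    refine ((hAp p.1).add mdifferentiableAt_const).prodMk_space ?_
    exact mdifferentiableAt_clm_of_apply fun w ↦
      (b p.2).differentiableAt.mdifferentiableAt.comp x (hAp w)
  exact h1.comp x h2

end Manifold

/-! ### Differentiability of the tangential part -/

namespace NonHorizontalSubmanifold

variable {n : ℕ} {G : Type*} [TopologicalSpace G] [ChartedSpace (EuclideanSpace ℝ (Fin n)) G]
  [Group G] [LieGroup (𝓡 n) ∞ G]
  {m : ℕ} {M : Type*} [TopologicalSpace M] [ChartedSpace (EuclideanSpace ℝ (Fin m)) M]
  {𝔖 : Stratification n G} (N : NonHorizontalSubmanifold 𝔖 m M)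

lemma tangentialPart_normal {x : M} (ν : N.normal x) :
    N.tangentialPart x (ν : TangentSpace (𝓡 n) (N.incl x)) = 0 := by
  rw [tangentialPart, LinearMap.coe_toContinuousLinearMap', LinearMap.comp_apply,
    Submodule.projectionOnto_apply_right]
  exact map_zero _

lemma tangentialPart_mfderiv {x : M} (v : TangentSpace (𝓡 m) x) :
    N.tangentialPart x (mfderiv (𝓡 m) (𝓡 n) N.incl x v) = v := by
  have h : mfderiv (𝓡 m) (𝓡 n) N.incl x v =
    (N.tangentEquiv x v : TangentSpace (𝓡 n) (N.incl x)) := rfl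
  rw [h, tangentialPart, LinearMap.coe_toContinuousLinearMap', LinearMap.comp_apply,
    Submodule.projectionOnto_apply_left]
  exact (N.tangentEquiv x).symm_apply_apply _

/-- The metric on `D` is transported from `𝔤¹`, so normality can be tested in the fixed space `𝔤`,
where the linear system lives. -/
lemma leftTranslation_mem_normal {x : M} {d : EuclideanSpace ℝ (Fin n)} (hd : d ∈ 𝔖.layer 1)
    (h : ∀ e : 𝔖.layer 1, leftTranslation (N.incl x) (e : GroupLieAlgebra (𝓡 n) G) ∈ N.tangent x →
      𝔖.scalarProduct e ⟨d, hd⟩ = 0) :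
    (leftTranslation (N.incl x) d : TangentSpace (𝓡 n) (N.incl x)) ∈ N.normal x := by
  refine ⟨𝔖.horizontalEquiv (N.incl x) ⟨d, hd⟩, fun v hv ↦ ?_, rfl⟩
  obtain ⟨e, rfl⟩ := (𝔖.horizontalEquiv (N.incl x)).surjective v
  have h2 : 𝔖.metric (N.incl x) (𝔖.horizontalEquiv (N.incl x) e)
      (𝔖.horizontalEquiv (N.incl x) ⟨d, hd⟩) = 𝔖.scalarProduct e ⟨d, hd⟩ := by
    simp [Stratification.metric]
  exact h2.trans (h e hv)

lemma leftTranslation_leftCoord (V : Π x : M, TangentSpace (𝓡 n) (N.incl x)) (y : M) :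
    leftTranslation (N.incl y) (leftCoord N.incl V y) = V y :=
  (leftTranslation (N.incl y)).apply_symm_apply _

section

variable [IsManifold (𝓡 m) ∞ M]

/-- The differential of the inclusion at `y`, from the model space of `M` to `𝔤`, in the
trivialisation of `TM` at `x` and the left trivialisation of `TG`. -/
def trivializedDifferential (x y : M) : EuclideanSpace ℝ (Fin m) →L[ℝ] EuclideanSpace ℝ (Fin n) :=
  ((leftTranslation (n := n) (N.incl y)).symm.toContinuousLinearMap :
      TangentSpace (𝓡 n) (N.incl y) →L[ℝ] EuclideanSpace ℝ (Fin n)).comp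
    ((mfderiv (𝓡 m) (𝓡 n) N.incl y).comp
      ((trivializationAt (EuclideanSpace ℝ (Fin m)) (TangentSpace (𝓡 m)) x).symmL ℝ y))

lemma mdifferentiableAt_trivializedDifferential (x : M) :
    MDifferentiableAt (𝓡 m) 𝓘(ℝ, EuclideanSpace ℝ (Fin m) →L[ℝ] EuclideanSpace ℝ (Fin n))
      (N.trivializedDifferential x) x := by
  refine mdifferentiableAt_clm_of_apply fun w ↦ ?_
  let e := trivializationAt (EuclideanSpace ℝ (Fin m)) (TangentSpace (𝓡 m) : M → Type _) x
  -- The local field that is constantly `w` in the trivialisation at `x` is differentiable there;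
  -- its push-forward has `N.trivializedDifferential x y w` as left coordinate.
  have h : MDifferentiableAt (𝓡 m) (𝓡 m).tangent
      (fun y ↦ (⟨y, e.symmL ℝ y w⟩ : TangentBundle (𝓡 m) M)) x := by
    rw [mdifferentiableAt_section]
    refine (mdifferentiableAt_const (c := w)).congr_of_eventuallyEq ?_
    filter_upwards [e.open_baseSet.mem_nhds (mem_baseSet_trivializationAt _ _ x)] with y hy
    rw [e.symmL_apply hy]
    exact congrArg Prod.snd (e.apply_mk_symm hy w)
  exact N.mdifferentiableAt_leftCoord_push h

lemma leftTranslation_trivializedDifferential (x y : M) (w : EuclideanSpace ℝ (Fin m)) :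
    leftTranslation (N.incl y) (N.trivializedDifferential x y w) =
      mfderiv (𝓡 m) (𝓡 n) N.incl y
        ((trivializationAt (EuclideanSpace ℝ (Fin m)) (TangentSpace (𝓡 m)) x).symmL ℝ y w) :=
  (leftTranslation (N.incl y)).apply_symm_apply _

lemma injective_trivializedDifferential {x y : M}
    (hy : y ∈ (trivializationAt (EuclideanSpace ℝ (Fin m)) (TangentSpace (𝓡 m)) x).baseSet) :
    Function.Injective (N.trivializedDifferential x y) := by
  refine (leftTranslation (n := n) (N.incl y)).symm.injective.comp
    ((N.injective_mfderiv y).comp ?_)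
  exact Function.LeftInverse.injective fun w ↦
    (trivializationAt (EuclideanSpace ℝ (Fin m)) (TangentSpace (𝓡 m)) x).continuousLinearMapAt_symmL
      (R := ℝ) hy w

lemma mfderiv_eq_leftTranslation_trivializedDifferential {x y : M}
    (hy : y ∈ (trivializationAt (EuclideanSpace ℝ (Fin m)) (TangentSpace (𝓡 m)) x).baseSet)
    (v : TangentSpace (𝓡 m) y) :
    mfderiv (𝓡 m) (𝓡 n) N.incl y v =
      leftTranslation (N.incl y) (N.trivializedDifferential x y
        ((trivializationAt (EuclideanSpace ℝ (Fin m)) (TangentSpace (𝓡 m)) x).continuousLinearMapAt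
          ℝ y v)) := by
  refine Eq.trans ?_ (N.leftTranslation_trivializedDifferential x y _).symm
  exact congrArg _ (Trivialization.symmL_continuousLinearMapAt _ hy v).symm

lemma range_trivializedDifferential_sup {x y : M}
    (hy : y ∈ (trivializationAt (EuclideanSpace ℝ (Fin m)) (TangentSpace (𝓡 m)) x).baseSet) :
    LinearMap.range (N.trivializedDifferential x y).toLinearMap ⊔
      (𝔖.layer 1 : Submodule ℝ (EuclideanSpace ℝ (Fin n))) = ⊤ := by
  rw [eq_top_iff]
  rintro u -
  have h := N.transverse y
  obtain ⟨_, ⟨a, rfl⟩, _, ⟨d, hd, rfl⟩, h⟩ := Submodule.mem_sup.1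
    (h ▸ Submodule.mem_top : (leftTranslation (N.incl y) u : TangentSpace (𝓡 n) (N.incl y)) ∈ _)
  refine Submodule.mem_sup.2 ⟨_, ⟨(trivializationAt (EuclideanSpace ℝ (Fin m))
    (TangentSpace (𝓡 m)) x).continuousLinearMapAt ℝ y a, rfl⟩, d, hd,
    (leftTranslation (N.incl y)).injective ?_⟩
  refine Eq.trans ?_ h
  refine ((leftTranslation (n := n) (N.incl y)).map_add _ _).trans ?_
  refine congrArg₂ (· + ·) ?_ rfl
  exact (N.mfderiv_eq_leftTranslation_trivializedDifferential hy a).symm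

/-- The tangential part of a differentiable vector field along `M` is differentiable. -/
lemma mdifferentiableAt_leftCoord_push_tangentialPart
    {V : Π x : M, TangentSpace (𝓡 n) (N.incl x)} {x : M}
    (hV : MDifferentiableAt (𝓡 m) 𝓘(ℝ, EuclideanSpace ℝ (Fin n)) (leftCoord N.incl V) x) :
    MDifferentiableAt (𝓡 m) 𝓘(ℝ, EuclideanSpace ℝ (Fin n))
      (leftCoord N.incl (N.push fun y ↦ N.tangentialPart y (V y))) x := by
  obtain ⟨p, b, hp, hbp, hbs, hb⟩ := exists_projection_and_extension
    (F := EuclideanSpace ℝ (Fin n)) (𝔖.layer 1) 𝔖.scalarProduct 𝔖.posDef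
  let e := trivializationAt (EuclideanSpace ℝ (Fin m)) (TangentSpace (𝓡 m) : M → Type _) x
  have hx : x ∈ e.baseSet := mem_baseSet_trivializationAt _ _ x
  let A := N.trivializedDifferential x
  have hinv : ∀ y ∈ e.baseSet, (splittingSystem p b (A y)).IsInvertible := fun y hy ↦
    isInvertible_splittingSystem hp hbp hb (N.injective_trivializedDifferential hy)
      (N.range_trivializedDifferential_sup hy)
  have hA := N.mdifferentiableAt_trivializedDifferential x
  -- With right-hand side `(V, 0)` the solution `(w, u)` satisfies `V = A w + p u`, and `A w` will
  -- be the left coordinate of `V^⊤`.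
  have hsol : MDifferentiableAt (𝓡 m)
      𝓘(ℝ, EuclideanSpace ℝ (Fin m) × EuclideanSpace ℝ (Fin n))
      (fun y ↦ (splittingSystem p b (A y)).inverse (leftCoord N.incl V y, 0)) x :=
    (mdifferentiableAt_inverse_splittingSystem hA (hinv x hx)).clm_apply
      (hV.prodMk_space mdifferentiableAt_const)
  have hfst : MDifferentiableAt (𝓡 m) 𝓘(ℝ, EuclideanSpace ℝ (Fin m))
      (fun y ↦ ((splittingSystem p b (A y)).inverse (leftCoord N.incl V y, 0)).1) x :=
    (ContinuousLinearMap.fst ℝ (EuclideanSpace ℝ (Fin m))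
      (EuclideanSpace ℝ (Fin n))).differentiableAt.mdifferentiableAt.comp x hsol
  refine (hA.clm_apply hfst).congr_of_eventuallyEq ?_
  filter_upwards [e.open_baseSet.mem_nhds hx] with y hy
  obtain ⟨w, u, hwu⟩ : ∃ w u,
      (splittingSystem p b (A y)).inverse (leftCoord N.incl V y, 0) = (w, u) := ⟨_, _, rfl⟩
  have hsys : splittingSystem p b (A y) (w, u) = (leftCoord N.incl V y, 0) := by
    rw [← hwu]
    exact (hinv y hy).self_apply_inverse _
  rw [splittingSystem_apply, Prod.mk.injEq] at hsys
  obtain ⟨h1, h2⟩ := hsys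
  -- A vector of `𝔤¹` whose translate is tangent has the form `A a`, and `b(p u, A a) = b(u, A a) =
  -- 0` by the second equation.
  have hν : (leftTranslation (N.incl y) (p u) : TangentSpace (𝓡 n) (N.incl y)) ∈ N.normal y := by
    refine N.leftTranslation_mem_normal (hp u) ?_
    rintro e' ⟨a, ha⟩
    have h3 : A y (e.continuousLinearMapAt ℝ y a) = e'.1 :=
      (leftTranslation (N.incl y)).injective
        ((N.mfderiv_eq_leftTranslation_trivializedDifferential hy a).symm.trans ha)
    have h4 : b (p u) e'.1 = 0 := by
      refine (hbp u e'.1 e'.2).symm.trans ?_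
      rw [← h3]
      exact DFunLike.congr_fun h2 _
    rw [𝔖.isSymm.eq, ← h4]
    exact (hbs ⟨p u, hp u⟩ e').symm
  have hVy : V y =
      mfderiv (𝓡 m) (𝓡 n) N.incl y (e.symmL ℝ y w) + leftTranslation (N.incl y) (p u) := by
    rw [← N.leftTranslation_leftCoord V y, ← h1]
    refine ((leftTranslation (n := n) (N.incl y)).map_add _ _).trans ?_
    exact congrArg₂ (· + ·) (N.leftTranslation_trivializedDifferential x y w) rfl
  -- The summands just found are tangent and normal, so uniqueness of the splitting identifies them.
  have htan : N.tangentialPart y (V y) = e.symmL ℝ y w := by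
    rw [hVy, map_add, N.tangentialPart_mfderiv, N.tangentialPart_normal ⟨_, hν⟩, add_zero]
  rw [hwu]
  change (leftTranslation (N.incl y)).symm
    (mfderiv (𝓡 m) (𝓡 n) N.incl y (N.tangentialPart y (V y))) = _
  rw [htan]
  rfl

end

end NonHorizontalSubmanifold

/-! ### Flatness of the ambient connection -/

section AmbientConnection

variable {n : ℕ} {G : Type*} [TopologicalSpace G] [ChartedSpace (EuclideanSpace ℝ (Fin n)) G]
  [Group G] [LieGroup (𝓡 n) ∞ G]
  {m : ℕ} {M : Type*} [TopologicalSpace M] [ChartedSpace (EuclideanSpace ℝ (Fin m)) M]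
  {φ : M → G} {V : Π x : M, TangentSpace (𝓡 n) (φ x)} {X Y : Π x : M, TangentSpace (𝓡 m) x} {x : M}

/-- Iterating `∇̄` thereby becomes iterating directional derivatives of a vector-valued function. -/
lemma leftCoord_ambientDeriv (φ : M → G) (V : Π x : M, TangentSpace (𝓡 n) (φ x))
    (X : Π x : M, TangentSpace (𝓡 m) x) :
    leftCoord φ (fun y ↦ ambientDeriv φ V y (X y)) =
      fun y ↦ mvfderiv (𝓡 m) (leftCoord φ V) y (X y) :=
  funext fun y ↦ (leftTranslation (n := n) (φ y)).symm_apply_apply _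

lemma ambientDeriv_neg (φ : M → G) (V : Π x : M, TangentSpace (𝓡 n) (φ x)) (x : M)
    (v : TangentSpace (𝓡 m) x) : ambientDeriv φ (-V) x v = -ambientDeriv φ V x v := by
  have h : leftCoord φ (-V) = -leftCoord φ V :=
    funext fun y ↦ (leftTranslation (φ y)).symm.map_neg _
  rw [ambientDeriv, h, mvfderiv_neg]
  exact (leftTranslation (n := n) (φ x)).map_neg _

/-- The connection `∇̄` is flat. -/
lemma ambientDeriv_mlieBracket [IsManifold (𝓡 m) ∞ M]
    (hV : ContMDiffAt (𝓡 m) 𝓘(ℝ, EuclideanSpace ℝ (Fin n)) 2 (leftCoord φ V) x)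
    (hX : MDifferentiableAt (𝓡 m) (𝓡 m).tangent (fun y ↦ (⟨y, X y⟩ : TangentBundle (𝓡 m) M)) x)
    (hY : MDifferentiableAt (𝓡 m) (𝓡 m).tangent (fun y ↦ (⟨y, Y y⟩ : TangentBundle (𝓡 m) M)) x) :
    ambientDeriv φ V x (mlieBracket (𝓡 m) X Y x) =
      ambientDeriv φ (fun y ↦ ambientDeriv φ V y (Y y)) x (X x) -
        ambientDeriv φ (fun y ↦ ambientDeriv φ V y (X y)) x (Y x) := by
  refine (congrArg (fun w : EuclideanSpace ℝ (Fin n) ↦ leftTranslation (n := n) (φ x) w)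
    (mvfderiv_mlieBracket hV hX hY)).trans ?_
  rw [ambientDeriv, ambientDeriv, leftCoord_ambientDeriv, leftCoord_ambientDeriv]
  exact (leftTranslation (n := n) (φ x)).map_sub _ _

end AmbientConnection

/-! ### Splitting the flatness identity -/

namespace NonHorizontalSubmanifold

variable {n : ℕ} {G : Type*} [TopologicalSpace G] [ChartedSpace (EuclideanSpace ℝ (Fin n)) G]
  [Group G] [LieGroup (𝓡 n) ∞ G]
  {m : ℕ} {M : Type*} [TopologicalSpace M] [ChartedSpace (EuclideanSpace ℝ (Fin m)) M]
  {𝔖 : Stratification n G} (N : NonHorizontalSubmanifold 𝔖 m M)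

lemma contMDiffAt_leftCoord_normal {U : Set M} (hU : IsOpen U) {ξ : Π x : M, N.normal x}
    (hξ : N.SmoothNormalField U ξ) {x : M} (hx : x ∈ U) :
    ContMDiffAt (𝓡 m) 𝓘(ℝ, EuclideanSpace ℝ (Fin n)) ∞ (leftCoord N.incl fun y ↦ (ξ y).1) x :=
  contMDiff_leftTrivialization.contMDiffAt.comp x (hξ.contMDiffAt (hU.mem_nhds hx))

lemma secondFundamentalForm_neg (X W : Π x : M, TangentSpace (𝓡 m) x) (x : M) :
    N.secondFundamentalForm X (fun y ↦ -W y) x = -N.secondFundamentalForm X W x := by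
  have h : N.push (fun y ↦ -W y) = -N.push W :=
    funext fun y ↦ (mfderiv (𝓡 m) (𝓡 n) N.incl y).map_neg _
  rw [secondFundamentalForm, h, ambientDeriv_neg, map_neg]
  rfl

variable [IsManifold (𝓡 m) ∞ M]

lemma contMDiffAt_leftCoord_push {U : Set M} (hU : IsOpen U) {Y : Π x : M, TangentSpace (𝓡 m) x}
    (hY : SmoothTangentField U Y) {x : M} (hx : x ∈ U) :
    ContMDiffAt (𝓡 m) 𝓘(ℝ, EuclideanSpace ℝ (Fin n)) ∞ (leftCoord N.incl (N.push Y)) x := by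
  have h : ContMDiff (𝓡 m).tangent (𝓡 n).tangent ∞ (tangentMap (𝓡 m) (𝓡 n) N.incl) :=
    N.contMDiff_incl.contMDiff_tangentMap (by simp)
  have h2 := contMDiff_leftTrivialization.comp h
  have h3 : ContMDiffAt (𝓡 m) (𝓡 m).tangent ∞ (fun y ↦ (⟨y, Y y⟩ : TangentBundle (𝓡 m) M)) x :=
    ContMDiffOn.contMDiffAt hY (hU.mem_nhds hx)
  have h4 := (h2 ⟨x, Y x⟩).comp x h3
  exact h4

variable {V : Π x : M, TangentSpace (𝓡 n) (N.incl x)} {X Y : Π x : M, TangentSpace (𝓡 m) x} {x : M}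

/-- `∇̄V = ∇̄(V^⊤) + ∇̄(V^⊥)`. -/
lemma ambientDeriv_eq_add
    (hV : MDifferentiableAt (𝓡 m) 𝓘(ℝ, EuclideanSpace ℝ (Fin n)) (leftCoord N.incl V) x) :
    ambientDeriv (m := m) N.incl V x =
      ambientDeriv N.incl (N.push fun y ↦ N.tangentialPart y (V y)) x +
        ambientDeriv N.incl (fun y ↦ (N.normalPart y (V y)).1) x := by
  have htop := N.mdifferentiableAt_leftCoord_push_tangentialPart hV
  -- The normal part inherits differentiability as `V - V^⊤`.
  have hperp : MDifferentiableAt (𝓡 m) 𝓘(ℝ, EuclideanSpace ℝ (Fin n))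
      (leftCoord N.incl fun y ↦ (N.normalPart y (V y)).1) x := by
    refine (hV.sub htop).congr_of_eventuallyEq (Eventually.of_forall fun y ↦ ?_)
    refine Eq.trans ?_ ((leftTranslation (n := n) (N.incl y)).symm.map_sub _ _)
    exact congrArg _ (eq_sub_of_add_eq' (N.push_tangentialPart_add_normalPart y (V y)))
  rw [← ambientDeriv_add _ htop hperp]
  congr 1
  exact funext fun y ↦ (N.push_tangentialPart_add_normalPart y (V y)).symm

/-- The flatness of `∇̄` in terms of the tangential and normal parts of `∇̄_X V` and `∇̄_Y V`. -/
lemma ambientDeriv_mlieBracket_eq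
    (hV : ContMDiffAt (𝓡 m) 𝓘(ℝ, EuclideanSpace ℝ (Fin n)) ∞ (leftCoord N.incl V) x)
    (hX : MDifferentiableAt (𝓡 m) (𝓡 m).tangent (fun y ↦ (⟨y, X y⟩ : TangentBundle (𝓡 m) M)) x)
    (hY : MDifferentiableAt (𝓡 m) (𝓡 m).tangent (fun y ↦ (⟨y, Y y⟩ : TangentBundle (𝓡 m) M)) x) :
    ambientDeriv N.incl V x (mlieBracket (𝓡 m) X Y x) =
      (ambientDeriv N.incl
          (N.push fun y ↦ N.tangentialPart y (ambientDeriv N.incl V y (Y y))) x (X x) +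
        ambientDeriv N.incl (fun y ↦ (N.normalPart y (ambientDeriv N.incl V y (Y y))).1) x (X x)) -
      (ambientDeriv N.incl
          (N.push fun y ↦ N.tangentialPart y (ambientDeriv N.incl V y (X y))) x (Y x) +
        ambientDeriv N.incl (fun y ↦ (N.normalPart y (ambientDeriv N.incl V y (X y))).1) x
          (Y x)) := by
  have hV2 : ContMDiffAt (𝓡 m) 𝓘(ℝ, EuclideanSpace ℝ (Fin n)) 2 (leftCoord N.incl V) x :=
    hV.of_le ENat.LEInfty.out
  have hd {W : Π x : M, TangentSpace (𝓡 m) x} (hW : MDifferentiableAt (𝓡 m) (𝓡 m).tangent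
      (fun y ↦ (⟨y, W y⟩ : TangentBundle (𝓡 m) M)) x) :
      MDifferentiableAt (𝓡 m) 𝓘(ℝ, EuclideanSpace ℝ (Fin n))
        (leftCoord N.incl fun y ↦ ambientDeriv N.incl V y (W y)) x := by
    rw [leftCoord_ambientDeriv]
    exact mdifferentiableAt_mvfderiv_apply hV2 hW
  rw [ambientDeriv_mlieBracket hV2 hX hY, N.ambientDeriv_eq_add (hd hX),
    N.ambientDeriv_eq_add (hd hY)]
  rfl

end NonHorizontalSubmanifold

end SubRiemannian

end

/-! ### The Gauss, Codazzi and Ricci equations -/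

theorem mainTheorem9 {n m : ℕ} {G : Type*} [TopologicalSpace G]
    [ChartedSpace (EuclideanSpace ℝ (Fin n)) G] [Group G] [LieGroup (𝓡 n) ∞ G]
    [SimplyConnectedSpace G] [Group.IsNilpotent G] (𝔖 : SubRiemannian.Stratification n G)
    {M : Type*} [TopologicalSpace M] [ChartedSpace (EuclideanSpace ℝ (Fin m)) M]
    [IsManifold (𝓡 m) ∞ M] (N : SubRiemannian.NonHorizontalSubmanifold 𝔖 m M)
    (U : Set M) (hU : IsOpen U) (X Y Z : Π x : M, TangentSpace (𝓡 m) x) (ξ : Π x : M, N.normal x)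
    (hX : SubRiemannian.SmoothTangentField U X) (hY : SubRiemannian.SmoothTangentField U Y)
    (hZ : SubRiemannian.SmoothTangentField U Z) (hξ : N.SmoothNormalField U ξ) :
    (∀ x ∈ U, N.curvature X Y Z x =
      N.weingarten (N.secondFundamentalForm Y Z) X x -
        N.weingarten (N.secondFundamentalForm X Z) Y x) ∧
    (∀ x ∈ U, N.derivSecondFundamentalForm Y X Z x - N.derivSecondFundamentalForm X Y Z x -
      N.secondFundamentalForm (N.torsion X Y) Z x = 0) ∧
    (∀ x ∈ U, N.normalCurvature X Y ξ x =
      N.secondFundamentalForm X (N.weingarten ξ Y) x -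
        N.secondFundamentalForm Y (N.weingarten ξ X) x) := by
  have hX' : ∀ x ∈ U, MDifferentiableAt (𝓡 m) (𝓡 m).tangent
      (fun y ↦ (⟨y, X y⟩ : TangentBundle (𝓡 m) M)) x := fun x hx ↦
    (ContMDiffOn.contMDiffAt hX (hU.mem_nhds hx)).mdifferentiableAt (by simp)
  have hY' : ∀ x ∈ U, MDifferentiableAt (𝓡 m) (𝓡 m).tangent
      (fun y ↦ (⟨y, Y y⟩ : TangentBundle (𝓡 m) M)) x := fun x hx ↦
    (ContMDiffOn.contMDiffAt hY (hU.mem_nhds hx)).mdifferentiableAt (by simp)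
  -- Flatness applied to `Z`: its tangential part gives Gauss, its normal part Codazzi.
  have hpush := fun x hx ↦ N.ambientDeriv_mlieBracket_eq
    (N.contMDiffAt_leftCoord_push hU hZ hx) (hX' x hx) (hY' x hx)
  refine ⟨fun x hx ↦ ?_, fun x hx ↦ ?_, fun x hx ↦ ?_⟩
  · have h := congrArg (N.tangentialPart x) (hpush x hx)
    rw [map_sub, map_add, map_add] at h
    change N.nabla (VectorField.mlieBracket (𝓡 m) X Y) Z x =
      (N.nabla X (N.nabla Y Z) x + N.tangentialPart x (SubRiemannian.ambientDeriv N.incl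
        (fun y ↦ (N.secondFundamentalForm Y Z y).1) x (X x))) -
      (N.nabla Y (N.nabla X Z) x + N.tangentialPart x (SubRiemannian.ambientDeriv N.incl
        (fun y ↦ (N.secondFundamentalForm X Z y).1) x (Y x))) at h
    change N.nabla X (N.nabla Y Z) x - N.nabla Y (N.nabla X Z) x -
      N.nabla (VectorField.mlieBracket (𝓡 m) X Y) Z x = _
    rw [h, SubRiemannian.NonHorizontalSubmanifold.weingarten,
      SubRiemannian.NonHorizontalSubmanifold.weingarten]
    abel
  · have h := congrArg (N.normalPart x) (hpush x hx)
    rw [map_sub, map_add, map_add] at h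
    change N.secondFundamentalForm (VectorField.mlieBracket (𝓡 m) X Y) Z x =
      (N.secondFundamentalForm X (N.nabla Y Z) x +
        N.normalNabla X (N.secondFundamentalForm Y Z) x) -
      (N.secondFundamentalForm Y (N.nabla X Z) x +
        N.normalNabla Y (N.secondFundamentalForm X Z) x) at h
    -- `S` depends on its first argument only through the value at `x` and is linear in it, so the
    -- pointwise formula for the torsion suffices.
    have hT : N.secondFundamentalForm (N.torsion X Y) Z x =
        N.secondFundamentalForm (N.nabla X Y) Z x - N.secondFundamentalForm (N.nabla Y X) Z x -
          N.secondFundamentalForm (VectorField.mlieBracket (𝓡 m) X Y) Z x := by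
      have hXY : N.torsion X Y x =
          N.nabla X Y x - N.nabla Y X x - VectorField.mlieBracket (𝓡 m) X Y x :=
        N.connection.torsion_apply (hX' x hx) (hY' x hx)
      rw [SubRiemannian.NonHorizontalSubmanifold.secondFundamentalForm, hXY, map_sub, map_sub,
        map_sub, map_sub]
      rfl
    change (N.normalNabla Y (N.secondFundamentalForm X Z) x -
        N.secondFundamentalForm (N.nabla Y X) Z x - N.secondFundamentalForm X (N.nabla Y Z) x) -
      (N.normalNabla X (N.secondFundamentalForm Y Z) x -
        N.secondFundamentalForm (N.nabla X Y) Z x - N.secondFundamentalForm Y (N.nabla X Z) x) -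
      _ = 0
    rw [hT, h]
    abel
  · have h := congrArg (N.normalPart x) (N.ambientDeriv_mlieBracket_eq
      (N.contMDiffAt_leftCoord_normal hU hξ hx) (hX' x hx) (hY' x hx))
    rw [map_sub, map_add, map_add] at h
    change N.normalNabla (VectorField.mlieBracket (𝓡 m) X Y) ξ x =
      (N.secondFundamentalForm X (fun y ↦ N.tangentialPart y (SubRiemannian.ambientDeriv N.incl
          (fun y ↦ (ξ y).1) y (Y y))) x + N.normalNabla X (N.normalNabla Y ξ) x) -
      (N.secondFundamentalForm Y (fun y ↦ N.tangentialPart y (SubRiemannian.ambientDeriv N.incl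
          (fun y ↦ (ξ y).1) y (X y))) x + N.normalNabla Y (N.normalNabla X ξ) x) at h
    change N.normalNabla X (N.normalNabla Y ξ) x - N.normalNabla Y (N.normalNabla X ξ) x -
      N.normalNabla (VectorField.mlieBracket (𝓡 m) X Y) ξ x =
      N.secondFundamentalForm X (fun y ↦ -N.tangentialPart y (SubRiemannian.ambientDeriv N.incl
          (fun y ↦ (ξ y).1) y (Y y))) x -
      N.secondFundamentalForm Y (fun y ↦ -N.tangentialPart y (SubRiemannian.ambientDeriv N.incl
          (fun y ↦ (ξ y).1) y (X y))) x
    -- The sign in `A_ξ` sits inside the field being differentiated and has to be pulled out of `S`.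
    rw [h, N.secondFundamentalForm_neg, N.secondFundamentalForm_neg]
    abel
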